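/- Let $X$ be a finite set, let $\mathcal F\subseteq 2^X$ be a system of nonempty subsets of $X$, and let $G=(V,E)$ be a finite simple graph without isolated vertices that is (isomorphic to) the Kneser graph $\mathrm{KG}(\mathcal F)$, whose vertices are the sets of $\mathcal F$ and whose edges are the pairs of disjoint sets of $\mathcal F$. Notation. For $A\subseteq V$ let $\mathrm{CN}(A)=\{v\in V:\{a,v\}\in E\text{ for all }a\in A\}$. Write $A'\uplus A''=(A'\times\{1\})\cup(A''\times\{2\})$, and let $\mathrm{Box}(G)$ be the set of pairs $(A',A'')$ of disjoint subsets of $V$ (possibly empty) such that every vertex of $A'$ is adjacent to every vertex of $A''$. For a set system $\mathcal S$ let $\Delta\mathcal S$ be the order complex of $(\mathcal S\setminus\{\emptyset\},\subseteq)$, i.e. the simplicial complex of its chains. Define the simplicial complexes - $\mathsf B(G)=\{A'\uplus A'':(A',A'')\in\mathrm{Box}(G),\ \mathrm{CN}(A')\ne\emptyset,\ \mathrm{CN}(A'')\neq\emptyset\}$; - $\mathsf B_0(G)=\{A'\uplus A'':(A',A'')\in\mathrm{Box}(G)\}$; - $\mathsf B_1(G)=\Delta\{A'\uplus A'':(A',A'')\in\mathrm{Box}(G),\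 A'\neq\emptyset,\ A''\ne\emptyset\}$; - $\mathsf B_{\rm edge}(G)$, on the set of ordered pairs $(u,v)$ with $\{u,v\}\in E$, whose simplices are all subsets of the sets $A'\times A''$ with $(A',A'')\in\mathrm{Box}(G)$, $A'\ne\emptyset$, $A''\neq\emptyset$; - $\mathsf B_{\rm Sark}(\mathcal F)=\Delta\{B'\uplus B'':B',B''\subseteq X,\ B'\cap B''=\emptyset,\text{ at least one of }B',B''\text{ contains a set of }\mathcal F\}$; - $\mathsf B_1(\mathcal F)=\Delta\{B'\uplus B'':B',B''\subseteq X,\ B'\cap B''=\emptyset,\text{ both }B'\text{ and }B''\text{ contain a set of }\mathcal F\}$; - the Lovász complex $\mathsf L(G)=\Delta\{A\subseteq V: A\neq\emptyset,\ \mathrm{CN}(A)\ne\emptyset,\ \mathrm{CN}(\mathrm{CN}(A))=A\}$. Each of them carries a simplicial $\mathbb Z_2$-action: on $\mathsf L(G)$ it is given by $A\mapsto\mathrm{CN}(A)$, on $\mathsf B_{\rm edge}(G)$ by $(u,v)\mapsto(v,u)$, and on the others it is induced by interchanging the two copies of the ground set. For a simplicial complex $\mathsf K$ with such an action, let $\mathrm{ind}\,\mathsf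 K\in\{0,1,2,\dots\}\cup\{\infty\}$ be the smallest $n\ge 0$ such that there is a continuous map from the polyhedron of $\mathsf K$ to the sphere $S^n$ that commutes with the action on the polyhedron and the antipodal action $x\mapsto -x$ on $S^n$ ($\infty$ if there is no such $n$). Then $$\mathrm{ind}\,\mathsf B_1(G)=\mathrm{ind}\,\mathsf B_1(\mathcal F)=\mathrm{ind}\,\mathsf B_{\rm edge}(G)=\mathrm{ind}\,\mathsf B(G)=\mathrm{ind}\,\mathsf L(G)\le\mathrm{ind}\,\mathsf B_0(G)=\mathrm{ind}\,\mathsf B_{\rm Sark}(\mathcal F)\le\mathrm{ind}\,\mathsf B_1(G)+1 .$$ -/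

import Mathlib

/-! ### `ℤ₂`-spaces and the `ℤ₂`-index -/

/-- A `ℤ₂`-action on a topological space: a homeomorphism `ν` with `ν ∘ ν = id`. -/
structure Z2Action (T : Type*) [TopologicalSpace T] where
  toHomeomorph : T ≃ₜ T
  involutive : Function.Involutive toHomeomorph

/-- A continuous map that commutes with the `ℤ₂`-actions. -/
def IsZ2Map {T₁ T₂ : Type*} [TopologicalSpace T₁] [TopologicalSpace T₂]
    (ν₁ : Z2Action T₁) (ν₂ : Z2Action T₂) (f : T₁ → T₂) : Prop :=
  Continuous f ∧ ∀ x, f (ν₁.toHomeomorph x) = ν₂.toHomeomorph (f x)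

/-- The unit sphere `S^n` in `ℝ^(n+1)`. -/
abbrev UnitSphere (n : ℕ) : Type :=
  Metric.sphere (0 : EuclideanSpace ℝ (Fin (n + 1))) 1

/-- The antipodal action `x ↦ -x` on `S^n`. -/
noncomputable def antipodalAction (n : ℕ) : Z2Action (UnitSphere n) where
  toHomeomorph := Homeomorph.neg (UnitSphere n)
  involutive := fun x => neg_neg x

/-- The `ℤ₂`-index of `(T, ν)`: the least `n ≥ 0` for which there is a `ℤ₂`-map `T → S^n`,
and `⊤` if there is no such `n`. -/
noncomputable def z2Index {T : Type*} [TopologicalSpace T] (ν : Z2Action T) : ℕ∞ :=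
  sInf {m : ℕ∞ | ∃ n : ℕ, m = n ∧ ∃ f : T → UnitSphere n, IsZ2Map ν (antipodalAction n) f}

/-! ### Simplicial `ℤ₂`-complexes and their polyhedra -/

/-- A simplicial complex with vertices in `ι` (only the nonempty simplices are recorded),
together with an involution of the vertices that maps simplices to simplices. -/
structure Z2Complex (ι : Type*) extends PreAbstractSimplicialComplex ι where
  swap : Equiv.Perm ι
  swap_swap : ∀ v, swap (swap v) = v
  map_swap_mem : ∀ s ∈ faces, s.map swap.toEmbedding ∈ faces

namespace Z2Complex

variable {ι : Type*} (K : Z2Complex ι)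

/-- The polyhedron of `K` in barycentric coordinates, as a subspace of `ι → ℝ`. All complexes
considered here are finite, so that this is the usual topology. -/
def polyhedron : Set (ι → ℝ) :=
  {x | (∀ v, 0 ≤ x v) ∧ ∃ s ∈ K.faces, (∀ v, v ∉ s → x v = 0) ∧ ∑ v ∈ s, x v = 1}

theorem comp_swap_mem {x : ι → ℝ} (hx : x ∈ K.polyhedron) :
    (fun v => x (K.swap v)) ∈ K.polyhedron := by
  obtain ⟨h0, s, hs, hsupp, hsum⟩ := hx
  refine ⟨fun v => h0 _, s.map K.swap.toEmbedding, K.map_swap_mem s hs, ?_, ?_⟩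
  · intro v hv
    apply hsupp
    intro h
    apply hv
    rw [Finset.mem_map]
    exact ⟨K.swap v, h, K.swap_swap v⟩
  · rw [Finset.sum_map, ← hsum]
    exact Finset.sum_congr rfl fun v _ => congrArg x (K.swap_swap v)

theorem continuous_comp_swap : Continuous fun x : K.polyhedron =>
    (⟨fun v => x.1 (K.swap v), K.comp_swap_mem x.2⟩ : K.polyhedron) :=
  continuous_induced_rng.2
    (continuous_pi fun v => (continuous_apply (K.swap v)).comp continuous_subtype_val)

/-- The affine extension of the vertex involution to the polyhedron. -/
def polyhedronAction : Z2Action K.polyhedron where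
  toHomeomorph :=
    { toFun := fun x => ⟨fun v => x.1 (K.swap v), K.comp_swap_mem x.2⟩
      invFun := fun x => ⟨fun v => x.1 (K.swap v), K.comp_swap_mem x.2⟩
      left_inv := fun x => Subtype.ext (funext fun v => congrArg x.1 (K.swap_swap v))
      right_inv := fun x => Subtype.ext (funext fun v => congrArg x.1 (K.swap_swap v))
      continuous_toFun := K.continuous_comp_swap
      continuous_invFun := K.continuous_comp_swap }
  involutive := fun x => Subtype.ext (funext fun v => congrArg x.1 (K.swap_swap v))

/-- The `ℤ₂`-index of the polyhedron of `K`. -/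
noncomputable def ind : ℕ∞ := z2Index K.polyhedronAction

end Z2Complex

/-- The order complex of `P`: its simplices are the nonempty finite chains. The involution
has to preserve comparability (it may reverse the order). -/
def orderZ2Complex {P : Type*} [PartialOrder P] (ν : P → P) (hν : ∀ a, ν (ν a) = a)
    (hc : ∀ a b, a ≤ b → ν a ≤ ν b ∨ ν b ≤ ν a) : Z2Complex P where
  faces := {s | s.Nonempty ∧ IsChain (· ≤ ·) (s : Set P)}
  isRelLowerSet_faces := fun _ hs =>
    ⟨hs.1, fun _ hts ht => ⟨ht, hs.2.mono (Finset.coe_subset.2 hts)⟩⟩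
  swap := ⟨ν, ν, hν, hν⟩
  swap_swap := hν
  map_swap_mem := by
    rintro s ⟨hne, hs⟩
    refine ⟨hne.map, ?_⟩
    intro a ha b hb _
    simp only [Finset.coe_map, Set.mem_image, Finset.mem_coe] at ha hb
    obtain ⟨a, ha, rfl⟩ := ha
    obtain ⟨b, hb, rfl⟩ := hb
    rcases hs.total ha hb with h | h
    · exact hc a b h
    · exact (hc b a h).symm

/-! ### Pairs of subsets

A pair `A' ⊎ A''` of finite subsets of `α` is a finset `S` of the disjoint union `α ⊕ α` of two
copies of `α`, with `A' = S.toLeft` and `A'' = S.toRight`. -/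

/-- Interchange the shores: `A' ⊎ A'' ↦ A'' ⊎ A'`. -/
def swapShores {α : Type*} (S : Finset (α ⊕ α)) : Finset (α ⊕ α) :=
  S.map (Equiv.sumComm α α).toEmbedding

section swapShores

variable {α : Type*}

theorem toLeft_swapShores (S : Finset (α ⊕ α)) : (swapShores S).toLeft = S.toRight := by
  ext a
  simp [swapShores]

theorem toRight_swapShores (S : Finset (α ⊕ α)) : (swapShores S).toRight = S.toLeft := by
  ext a
  simp [swapShores]

theorem swapShores_swapShores (S : Finset (α ⊕ α)) : swapShores (swapShores S) = S := by
  ext (a | a) <;> simp [swapShores]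

end swapShores

/-- `Δ{A' ⊎ A'' : p A' A''}` with the action that interchanges the shores; the vertices are the
nonempty `A' ⊎ A''` with the symmetric property `p`, ordered by inclusion. -/
def pairOrderComplex {α : Type*} (p : Finset α → Finset α → Prop)
    (hp : ∀ A B, p A B → p B A) :
    Z2Complex {S : Finset (α ⊕ α) // S.Nonempty ∧ p S.toLeft S.toRight} :=
  orderZ2Complex
    (fun S => ⟨swapShores S.1, S.2.1.map, by
      rw [toLeft_swapShores, toRight_swapShores]; exact hp _ _ S.2.2⟩)
    (fun S => Subtype.ext (swapShores_swapShores S.1))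
    (fun _ _ h => Or.inl (Finset.map_subset_map.2 h))

/-- The complex `{A' ⊎ A'' : p A' A''}` for a symmetric hereditary property `p`, with the action
that interchanges the two copies of `α`. -/
def pairComplex {α : Type*} (p : Finset α → Finset α → Prop)
    (hp : ∀ A B, p A B → p B A)
    (hmono : ∀ A B A₁ B₁, A₁ ⊆ A → B₁ ⊆ B → p A B → p A₁ B₁) : Z2Complex (α ⊕ α) where
  faces := {S | S.Nonempty ∧ p S.toLeft S.toRight}
  isRelLowerSet_faces := fun _ hs =>
    ⟨hs.1, fun _ hts ht => ⟨ht, hmono _ _ _ _ (Finset.toLeft_subset_toLeft hts)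
      (Finset.toRight_subset_toRight hts) hs.2⟩⟩
  swap := Equiv.sumComm α α
  swap_swap := fun v => Sum.swap_swap v
  map_swap_mem := by
    rintro S ⟨hne, hS⟩
    refine ⟨hne.map, ?_⟩
    change p (swapShores S).toLeft (swapShores S).toRight
    rw [toLeft_swapShores, toRight_swapShores]
    exact hp _ _ hS

/-! ### Kneser graphs and box complexes -/

/-- The Kneser graph of a set system `F` on `X`: the vertices are the members of `F`, the edges
are the pairs of (distinct) disjoint members. -/
def kneserGraph {X : Type*} (F : Set (Finset X)) : SimpleGraph F where
  Adj A B := A ≠ B ∧ Disjoint A.1 B.1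
  symm := ⟨fun _ _ h => ⟨h.1.symm, h.2.symm⟩⟩
  loopless := ⟨fun _ h => h.1 rfl⟩

namespace SimpleGraph

variable {V : Type*} (G : SimpleGraph V)

/-- `CN(A)`: the set of common neighbours of `A`; in particular `CN(∅) = V`. -/
def CN (A : Set V) : Set V := {v | ∀ a ∈ A, G.Adj a v}

theorem CN_anti {A B : Set V} (h : A ⊆ B) : G.CN B ⊆ G.CN A :=
  fun _ hv a ha => hv a (h ha)

/-- `A'` and `A''` are disjoint and the bipartite graph `G[A', A'']` is complete. -/
def IsBox (A' A'' : Finset V) : Prop :=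
  Disjoint A' A'' ∧ ∀ a ∈ A', ∀ b ∈ A'', G.Adj a b

variable {G} in
theorem IsBox.symm {A B : Finset V} (h : G.IsBox A B) : G.IsBox B A :=
  ⟨h.1.symm, fun a ha b hb => (h.2 b hb a ha).symm⟩

variable {G} in
theorem IsBox.mono {A B A₁ B₁ : Finset V} (hA : A₁ ⊆ A) (hB : B₁ ⊆ B) (h : G.IsBox A B) :
    G.IsBox A₁ B₁ :=
  ⟨h.1.mono hA hB, fun a ha b hb => h.2 a (hA ha) b (hB hb)⟩

/-- The box complex `B(G)`. -/
def boxComplex : Z2Complex (V ⊕ V) :=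
  pairComplex
    (fun A' A'' => G.IsBox A' A'' ∧
      (G.CN (A' : Set V)).Nonempty ∧ (G.CN (A'' : Set V)).Nonempty)
    (fun _ _ h => ⟨h.1.symm, h.2.2, h.2.1⟩)
    (fun _ _ _ _ hA hB h => ⟨h.1.mono hA hB, h.2.1.mono (G.CN_anti (Finset.coe_subset.2 hA)),
      h.2.2.mono (G.CN_anti (Finset.coe_subset.2 hB))⟩)

/-- The box complex `B₀(G)`. -/
def boxComplexZero : Z2Complex (V ⊕ V) :=
  pairComplex G.IsBox (fun _ _ h => h.symm) (fun _ _ _ _ hA hB h => h.mono hA hB)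

/-- The box complex `B₁(G)`: the order complex of the boxes with two nonempty shores. -/
def boxComplexOne :
    Z2Complex {S : Finset (V ⊕ V) // S.Nonempty ∧
      (S.toLeft.Nonempty ∧ S.toRight.Nonempty ∧ G.IsBox S.toLeft S.toRight)} :=
  pairOrderComplex
    (fun A' A'' => A'.Nonempty ∧ A''.Nonempty ∧ G.IsBox A' A'')
    (fun _ _ h => ⟨h.2.1, h.1, h.2.2.symm⟩)

/-- The box complex `B_edge(G)` on the directed edges of `G`; the action reverses the edges. -/
def boxComplexEdge : Z2Complex G.Dart where
  faces := {D | D.Nonempty ∧ ∃ A' A'' : Finset V, A'.Nonempty ∧ A''.Nonempty ∧ G.IsBox A' A'' ∧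
    ∀ d ∈ D, d.fst ∈ A' ∧ d.snd ∈ A''}
  isRelLowerSet_faces := fun _ hs => ⟨hs.1, fun _ hts ht => by
    obtain ⟨-, A', A'', h₁, h₂, h₃, h₄⟩ := hs
    exact ⟨ht, A', A'', h₁, h₂, h₃, fun d hd => h₄ d (hts hd)⟩⟩
  swap := ⟨Dart.symm, Dart.symm, Dart.symm_symm, Dart.symm_symm⟩
  swap_swap := Dart.symm_symm
  map_swap_mem := by
    rintro D ⟨hne, A', A'', h₁, h₂, h₃, h₄⟩
    refine ⟨hne.map, A'', A', h₂, h₁, h₃.symm, ?_⟩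
    intro d hd
    obtain ⟨d₀, hd₀, rfl⟩ := Finset.mem_map.1 hd
    exact ⟨(h₄ d₀ hd₀).2, (h₄ d₀ hd₀).1⟩

/-- The Lovász complex `L(G)`: the order complex of the system of nonempty sets `A` with a common
neighbour that are closed, `CN(CN(A)) = A`; the action is `A ↦ CN(A)`. -/
def lovaszComplex :
    Z2Complex {A : Set V // A.Nonempty ∧ (G.CN A).Nonempty ∧ G.CN (G.CN A) = A} :=
  orderZ2Complex
    (fun A => ⟨G.CN A.1, A.2.2.1, by rw [A.2.2.2]; exact A.2.1, by rw [A.2.2.2]⟩)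
    (fun A => Subtype.ext A.2.2.2)
    (fun _ _ h => Or.inr (G.CN_anti h))

end SimpleGraph

section SetSystem

variable {X : Type*} (F : Set (Finset X))

/-- The Sarkaria complex `B_Sark(F)`: the order complex of the disjoint pairs `B' ⊎ B''` such that
at least one of `B'`, `B''` contains a set of `F`. -/
def sarkariaComplex :
    Z2Complex {S : Finset (X ⊕ X) // S.Nonempty ∧
      (Disjoint S.toLeft S.toRight ∧ ((∃ A ∈ F, A ⊆ S.toLeft) ∨ ∃ A ∈ F, A ⊆ S.toRight))} :=
  pairOrderComplex
    (fun B' B'' => Disjoint B' B'' ∧ ((∃ A ∈ F, A ⊆ B') ∨ ∃ A ∈ F, A ⊆ B''))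
    (fun _ _ h => ⟨h.1.symm, h.2.symm⟩)

/-- The Kneser box complex `B₁(F)`: the order complex of the disjoint pairs `B' ⊎ B''` such that
both `B'` and `B''` contain a set of `F`. -/
def kneserBoxComplexOne :
    Z2Complex {S : Finset (X ⊕ X) // S.Nonempty ∧
      (Disjoint S.toLeft S.toRight ∧ (∃ A ∈ F, A ⊆ S.toLeft) ∧ ∃ A ∈ F, A ⊆ S.toRight)} :=
  pairOrderComplex
    (fun B' B'' => Disjoint B' B'' ∧ (∃ A ∈ F, A ⊆ B') ∧ ∃ A ∈ F, A ⊆ B'')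
    (fun _ _ h => ⟨h.1.symm, h.2.2, h.2.1⟩)

end SetSystem

/-!
A `ℤ₂`-map `K → L` gives `ind K ≤ ind L`, and continuous equivariant vertex weights whose supports
are simplices give a `ℤ₂`-map after normalisation; in particular every complex maps to its
barycentric subdivision. The indices of `B₁(G)`, `B(G)`, `L(G)` and `B_edge(G)` agree because of
the cycle `B₁ → B → L → B_edge → B₁`: a box `A' ⊎ A''` goes to the closed sets `CN(CN(A'))` and
`CN(A'')`, a point of `|L(G)|` goes to the edges `(u, v)` for which `u` lies in more than half (by
mass) of its closed sets `A` and `v` in more than half of the sets `CN(A)`, and a set of edges goes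
to its sets of tails and heads.

Clearly `B₁ → B₀`. On `|B₀(G)|` the mass of the first shore minus that of the second is an odd
function. Its zero set maps to `B_edge`, and a `ℤ₂`-map from the zero set of an odd function to
`S^n` extends, by Tietze's theorem and antisymmetrisation, to a `ℤ₂`-map from the whole space
to `S^(n+1)`. Hence `ind B₀ ≤ ind B_edge + 1`.

Finally, taking unions of sets of vertices, and conversely taking the members contained in a given
set, translates between boxes of the Kneser graph and disjoint pairs of subsets of `X`.
-/

/-! ### `ℤ₂`-maps to spheres -/

namespace Z2Action

variable {T T₁ T₂ T₃ : Type*} [TopologicalSpace T] [TopologicalSpace T₁] [TopologicalSpace T₂]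
  [TopologicalSpace T₃]

/-- The preorder by which indices are compared: there is a `ℤ₂`-map from `(T₁, ν₁)`
to `(T₂, ν₂)`. -/
def HasZ2Map (ν₁ : Z2Action T₁) (ν₂ : Z2Action T₂) : Prop :=
  ∃ f : T₁ → T₂, IsZ2Map ν₁ ν₂ f

theorem HasZ2Map.trans {ν₁ : Z2Action T₁} {ν₂ : Z2Action T₂} {ν₃ : Z2Action T₃}
    (h₁ : ν₁.HasZ2Map ν₂) (h₂ : ν₂.HasZ2Map ν₃) : ν₁.HasZ2Map ν₃ := by
  obtain ⟨f, hf, hfν⟩ := h₁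
  obtain ⟨g, hg, hgν⟩ := h₂
  exact ⟨g ∘ f, hg.comp hf, fun x => by simp only [Function.comp_apply, hfν, hgν]⟩

theorem HasZ2Map.z2Index_le_z2Index {ν₁ : Z2Action T₁} {ν₂ : Z2Action T₂}
    (h : ν₁.HasZ2Map ν₂) : z2Index ν₁ ≤ z2Index ν₂ :=
  sInf_le_sInf fun _ ⟨n, hn, hf⟩ => ⟨n, hn, h.trans hf⟩

theorem HasZ2Map.z2Index_le {ν : Z2Action T} {n : ℕ} (h : ν.HasZ2Map (antipodalAction n)) :
    z2Index ν ≤ n :=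
  sInf_le ⟨n, rfl, h⟩

theorem exists_hasZ2Map_antipodalAction {ν : Z2Action T} (h : z2Index ν ≠ ⊤) :
    ∃ n : ℕ, z2Index ν = n ∧ ν.HasZ2Map (antipodalAction n) := by
  have hne : {m : ℕ∞ | ∃ n : ℕ, m = n ∧ ν.HasZ2Map (antipodalAction n)}.Nonempty :=
    Set.nonempty_iff_ne_empty.2 fun hempty => h ((congrArg sInf hempty).trans sInf_empty)
  exact csInf_mem hne

theorem z2Index_le_of_odd {ν : Z2Action T} {E : Type*} [NormedAddCommGroup E] [NormedSpace ℝ E]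
    {n : ℕ} (hE : Module.finrank ℝ E = n + 1) {g : T → E} (hg : Continuous g)
    (hodd : ∀ x, g (ν.toHomeomorph x) = -g x) (hg0 : ∀ x, g x ≠ 0) : z2Index ν ≤ n := by
  have : FiniteDimensional ℝ E := .of_finrank_pos (hE ▸ n.succ_pos)
  let φ : E ≃L[ℝ] EuclideanSpace ℝ (Fin (n + 1)) :=
    ContinuousLinearEquiv.ofFinrankEq (by rw [hE, finrank_euclideanSpace_fin])
  have hφg : Continuous fun x => φ (g x) := φ.continuous.comp hg
  have hφg0 : ∀ x, ‖φ (g x)‖ ≠ 0 := fun x =>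
    norm_ne_zero_iff.2 ((map_ne_zero_iff φ φ.injective).2 (hg0 x))
  refine HasZ2Map.z2Index_le ⟨fun x => ⟨‖φ (g x)‖⁻¹ • φ (g x), ?_⟩, ?_, fun x => ?_⟩
  · rw [mem_sphere_zero_iff_norm, norm_smul, norm_inv, norm_norm, inv_mul_cancel₀ (hφg0 x)]
  · exact ((hφg.norm.inv₀ hφg0).smul hφg).subtype_mk _
  · refine Subtype.ext ?_
    change _ = -(‖φ (g x)‖⁻¹ • φ (g x))
    simp only [hodd, map_neg, norm_neg, smul_neg]

/-- The restriction of a `ℤ₂`-action to an invariant subspace. -/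
def restrict (ν : Z2Action T) (s : Set T) (hs : ∀ x ∈ s, ν.toHomeomorph x ∈ s) :
    Z2Action s where
  toHomeomorph := ν.toHomeomorph.subtype fun x =>
    ⟨hs x, fun hx => by simpa only [ν.involutive x] using hs _ hx⟩
  involutive := fun x => Subtype.ext (ν.involutive x)

theorem apply_eq_zero_of_odd {ν : Z2Action T} {b : T → ℝ}
    (hodd : ∀ x, b (ν.toHomeomorph x) = -b x) {x : T} (hx : b x = 0) :
    b (ν.toHomeomorph x) = 0 :=
  (hodd x).trans (neg_eq_zero.2 hx)

theorem z2Index_le_z2Index_restrict_add_one [NormalSpace T] {ν : Z2Action T} {b : T → ℝ}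
    (hb : Continuous b) (hodd : ∀ x, b (ν.toHomeomorph x) = -b x) :
    z2Index ν ≤
      z2Index (ν.restrict {x | b x = 0} fun _ hx => apply_eq_zero_of_odd hodd hx) + 1 := by
  set ν₀ := ν.restrict {x | b x = 0} fun _ hx => apply_eq_zero_of_odd hodd hx
  by_cases htop : z2Index ν₀ = ⊤
  · rw [htop]
    exact le_top
  obtain ⟨n, hn, f, hf, hfν⟩ := exists_hasZ2Map_antipodalAction htop
  rw [hn]
  have hclosed : IsClosed {x | b x = 0} := isClosed_eq hb continuous_const
  obtain ⟨g, hg⟩ := ContinuousMap.exists_restrict_eq hclosed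
    (⟨fun x => (f x).1, continuous_subtype_val.comp hf⟩ :
      C({x | b x = 0}, EuclideanSpace ℝ (Fin (n + 1))))
  have hgf : ∀ x (hx : b x = 0), g x = (f ⟨x, hx⟩).1 := fun x hx => DFunLike.congr_fun hg ⟨x, hx⟩
  -- The antisymmetrisation `x ↦ g x - g (ν x)` is twice `f` on the zero set of `b`.
  have hgν : ∀ x, b x = 0 → g (ν.toHomeomorph x) = -g x := fun x hx => by
    rw [hgf x hx, hgf _ (apply_eq_zero_of_odd hodd hx)]
    exact congrArg Subtype.val (hfν ⟨x, hx⟩)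
  refine z2Index_le_of_odd (E := ℝ × EuclideanSpace ℝ (Fin (n + 1))) (n := n + 1)
    (g := fun x => (b x, g x - g (ν.toHomeomorph x))) ?_ ?_ (fun x => ?_) fun x h0 => ?_
  · rw [Module.finrank_prod, Module.finrank_self, finrank_euclideanSpace_fin, add_comm]
  · exact hb.prodMk (g.continuous.sub (g.continuous.comp ν.toHomeomorph.continuous))
  · rw [hodd, ν.involutive x, Prod.neg_mk, neg_sub]
  · obtain ⟨hbx, hgx⟩ := Prod.mk_eq_zero.1 h0
    rw [hgν x hbx, sub_neg_eq_add, ← two_smul ℝ, smul_eq_zero_iff_right two_ne_zero,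
      hgf x hbx] at hgx
    exact ne_zero_of_mem_unit_sphere _ hgx

end Z2Action

/-! ### Vertex weights and barycentric subdivision -/

namespace Z2Complex

variable {T : Type*} [TopologicalSpace T] {ι κ : Type*} (K : Z2Complex ι) (L : Z2Complex κ)

/-- There is a `ℤ₂`-map from the polyhedron of `K` to that of `L`. -/
abbrev HasZ2Map : Prop := K.polyhedronAction.HasZ2Map L.polyhedronAction

variable {K L}

theorem polyhedronAction_apply (x : K.polyhedron) (v : ι) :
    (K.polyhedronAction.toHomeomorph x).1 v = x.1 (K.swap v) := rfl

theorem continuous_coord (v : ι) : Continuous fun x : K.polyhedron => x.1 v :=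
  (continuous_apply v).comp continuous_subtype_val

theorem exists_support_mem_faces (x : K.polyhedron) : ∃ s ∈ K.faces, ∀ v, v ∈ s ↔ 0 < x.1 v := by
  classical
  obtain ⟨-, s, hs, hsupp, hsum⟩ := x.2
  have hpos : (s.filter fun v => 0 < x.1 v).Nonempty := by
    obtain ⟨v, hv, hxv⟩ := Finset.exists_lt_of_sum_lt (s := s) (f := fun _ => 0) (g := x.1)
      (by simp only [Finset.sum_const_zero, hsum, zero_lt_one])
    exact ⟨v, Finset.mem_filter.2 ⟨hv, hxv⟩⟩
  refine ⟨_, K.isRelLowerSet_faces hs |>.2 (Finset.filter_subset (0 < x.1 ·) s) hpos, fun v => ?_⟩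
  rw [Finset.mem_filter, and_iff_right_iff_imp]
  exact fun hv => by_contra fun hvs => hv.ne' (hsupp v hvs)

theorem sum_coord_eq_one [Fintype ι] (x : K.polyhedron) : ∑ v, x.1 v = 1 := by
  obtain ⟨-, s, -, hsupp, hsum⟩ := x.2
  rw [← hsum, Finset.sum_subset s.subset_univ fun v _ hv => hsupp v hv]

theorem hasZ2Map_of_weights [Finite κ] {ν : Z2Action T} (W : T → κ → ℝ)
    (hcont : ∀ k, Continuous fun x => W x k) (hnonneg : ∀ x k, 0 ≤ W x k)
    (hpos : ∀ x, ∃ k, 0 < W x k) (hsupp : ∀ x, ∃ s ∈ L.faces, ∀ k, 0 < W x k → k ∈ s)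
    (hν : ∀ x k, W (ν.toHomeomorph x) k = W x (L.swap k)) :
    ν.HasZ2Map L.polyhedronAction := by
  have := Fintype.ofFinite κ
  have hsum : ∀ x, 0 < ∑ k, W x k := fun x =>
    Finset.sum_pos' (fun k _ => hnonneg x k) ((hpos x).imp fun k hk => ⟨Finset.mem_univ k, hk⟩)
  refine ⟨fun x => ⟨fun k => W x k / ∑ k, W x k,
    fun k => div_nonneg (hnonneg x k) (hsum x).le, ?_⟩, ?_, fun x => ?_⟩
  · obtain ⟨s, hs, hWs⟩ := hsupp x
    have hzero : ∀ k, k ∉ s → W x k = 0 := fun k hk =>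
      ((hnonneg x k).eq_or_lt.resolve_right (mt (hWs k) hk)).symm
    refine ⟨s, hs, fun k hk => by simp only [hzero k hk, zero_div], ?_⟩
    rw [← Finset.sum_div, Finset.sum_subset s.subset_univ fun k _ hk => hzero k hk,
      div_self (hsum x).ne']
  · exact (continuous_pi fun k => (hcont k).div (continuous_finsetSum _ fun k _ => hcont k)
      fun x => (hsum x).ne').subtype_mk _
  · refine Subtype.ext (funext fun k => ?_)
    simp only [polyhedronAction_apply, hν]
    rw [Equiv.sum_comp L.swap (W x)]

/-- Each vertex is sent to the barycentre of its values. -/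
theorem hasZ2Map_of_rel [Finite ι] [Finite κ] (R : ι → κ → Prop)
    (hR : ∀ i k, R i k → R (K.swap i) (L.swap k)) (htotal : ∀ i, ∃ k, R i k)
    (hface : ∀ s ∈ K.faces, ∃ t ∈ L.faces, ∀ i ∈ s, ∀ k, R i k → k ∈ t) :
    K.HasZ2Map L := by
  classical
  have := Fintype.ofFinite ι
  have hRswap : ∀ i k, R (K.swap i) k ↔ R i (L.swap k) := fun i k =>
    ⟨fun h => by simpa only [K.swap_swap] using hR _ _ h,
      fun h => by simpa only [L.swap_swap] using hR _ _ h⟩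
  have hnonneg : ∀ (x : K.polyhedron) k, ∀ i ∈ Finset.univ.filter (R · k), 0 ≤ x.1 i :=
    fun x _ i _ => x.2.1 i
  refine hasZ2Map_of_weights (fun x k => ∑ i with R i k, x.1 i)
    (fun k => continuous_finsetSum _ fun i _ => continuous_coord i)
    (fun x k => Finset.sum_nonneg (hnonneg x k)) (fun x => ?_) (fun x => ?_) fun x k => ?_
  · obtain ⟨s, hs, hsx⟩ := exists_support_mem_faces x
    obtain ⟨i, hi⟩ := (K.isRelLowerSet_faces hs).1
    obtain ⟨k, hk⟩ := htotal i
    exact ⟨k, Finset.sum_pos' (hnonneg x k)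
      ⟨i, Finset.mem_filter.2 ⟨Finset.mem_univ i, hk⟩, (hsx i).1 hi⟩⟩
  · obtain ⟨s, hs, hsx⟩ := exists_support_mem_faces x
    obtain ⟨t, ht, hst⟩ := hface s hs
    refine ⟨t, ht, fun k hk => ?_⟩
    obtain ⟨i, hik, hi⟩ := Finset.exists_lt_of_sum_lt (f := fun _ => (0 : ℝ))
      (by simpa only [Finset.sum_const_zero] using hk)
    exact hst i ((hsx i).2 hi) k (Finset.mem_filter.1 hik).2
  · simp only [polyhedronAction_apply, ← hRswap]
    exact Finset.sum_equiv K.swap (fun i => by simp only [Finset.mem_filter, Finset.mem_univ,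
      true_and, K.swap_swap]) fun _ _ => rfl

end Z2Complex

section OrderComplex

open Z2Complex

variable {P Q : Type*} [PartialOrder P] [PartialOrder Q]

theorem exists_isGreatest_of_isChain {s : Finset P} (hs : s.Nonempty)
    (hchain : IsChain (· ≤ ·) (s : Set P)) : ∃ m, IsGreatest (s : Set P) m := by
  obtain ⟨m, hm⟩ := s.exists_maximal hs
  exact ⟨m, hm.1, fun a ha => (hchain.total ha hm.1).elim id (hm.2 ha)⟩

theorem exists_isLeast_of_isChain {s : Finset P} (hs : s.Nonempty)
    (hchain : IsChain (· ≤ ·) (s : Set P)) : ∃ m, IsLeast (s : Set P) m :=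
  exists_isGreatest_of_isChain (P := Pᵒᵈ) hs hchain.symm

variable [Finite P] [Finite Q] {νP : P → P} {hP : ∀ a, νP (νP a) = a}
  {hcP : ∀ a b, a ≤ b → νP a ≤ νP b ∨ νP b ≤ νP a} {νQ : Q → Q} {hQ : ∀ a, νQ (νQ a) = a}
  {hcQ : ∀ a b, a ≤ b → νQ a ≤ νQ b ∨ νQ b ≤ νQ a}

theorem orderZ2Complex_hasZ2Map_of_rel (R : P → Q → Prop)
    (hR : ∀ a p, R a p → R (νP a) (νQ p)) (htotal : ∀ a, ∃ p, R a p)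
    (hcomp : ∀ a b, a ≤ b → ∀ p q, R a p → R b q → p ≤ q ∨ q ≤ p) :
    (orderZ2Complex νP hP hcP).HasZ2Map (orderZ2Complex νQ hQ hcQ) := by
  classical
  have := Fintype.ofFinite Q
  refine hasZ2Map_of_rel R hR htotal fun s hs =>
    ⟨Finset.univ.filter fun p => ∃ a ∈ s, R a p, ⟨?_, ?_⟩, fun a ha p hp =>
      Finset.mem_filter.2 ⟨Finset.mem_univ p, a, ha, hp⟩⟩
  · obtain ⟨a, ha⟩ := hs.1
    obtain ⟨p, hp⟩ := htotal a
    exact ⟨p, Finset.mem_filter.2 ⟨Finset.mem_univ p, a, ha, hp⟩⟩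
  · intro p hp q hq _
    obtain ⟨-, a, ha, hap⟩ := Finset.mem_filter.1 (Finset.mem_coe.1 hp)
    obtain ⟨-, b, hb, hbq⟩ := Finset.mem_filter.1 (Finset.mem_coe.1 hq)
    rcases hs.2.total ha hb with hab | hba
    · exact hcomp a b hab p q hap hbq
    · exact (hcomp b a hba q p hbq hap).symm

theorem orderZ2Complex_hasZ2Map_of_monotone (f : P → Q) (hf : Monotone f)
    (hfν : ∀ a, f (νP a) = νQ (f a)) :
    (orderZ2Complex νP hP hcP).HasZ2Map (orderZ2Complex νQ hQ hcQ) := by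
  refine orderZ2Complex_hasZ2Map_of_rel (fun a p => f a = p) ?_ (fun a => ⟨_, rfl⟩) ?_
  · rintro a _ rfl
    exact hfν a
  · rintro a b hab _ _ rfl rfl
    exact Or.inl (hf hab)

end OrderComplex

namespace Z2Complex

variable {ι : Type*} (K : Z2Complex ι)

/-- The barycentric subdivision of `K`. -/
def sd : Z2Complex {s : Finset ι // s ∈ K.faces} :=
  orderZ2Complex (fun s => ⟨s.1.map K.swap.toEmbedding, K.map_swap_mem s.1 s.2⟩)
    (fun s => Subtype.ext <| (Finset.map_map _ _ s.1).trans <|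
      (congrArg s.1.map (Function.Embedding.ext K.swap_swap)).trans Finset.map_refl)
    (fun _ _ h => Or.inl (Finset.map_subset_map.2 h))

/-- A weight that is positive exactly when every coordinate of `x` in `s` exceeds every coordinate
outside `s`, so that the sets of positive weight form a chain. On the polyhedron of a complex it
gives vertex weights for the barycentric subdivision. -/
def separation [Fintype ι] [DecidableEq ι] (x : ι → ℝ) (s : Finset ι) : ℝ :=
  ∏ v ∈ s, ∏ u ∈ sᶜ, max 0 (x v - x u)

section Separation

variable [Fintype ι] [DecidableEq ι] {x : ι → ℝ} {s t : Finset ι}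

theorem separation_nonneg (x : ι → ℝ) (s : Finset ι) : 0 ≤ separation x s :=
  Finset.prod_nonneg fun _ _ => Finset.prod_nonneg fun _ _ => le_max_left _ _

theorem separation_pos_iff : 0 < separation x s ↔ ∀ v ∈ s, ∀ u ∉ s, x u < x v := by
  rw [(separation_nonneg x s).lt_iff_ne', separation]
  simp only [Finset.prod_ne_zero_iff, Finset.mem_compl, ne_eq, max_eq_left_iff, sub_nonpos, not_le]

theorem continuous_separation (s : Finset ι) : Continuous fun x : ι → ℝ => separation x s := by
  unfold separation
  fun_prop

theorem separation_comp_equiv (σ : Equiv.Perm ι) (x : ι → ℝ) (s : Finset ι) :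
    separation (x ∘ σ) s = separation x (s.map σ.toEmbedding) := by
  have hcompl : (s.map σ.toEmbedding)ᶜ = sᶜ.map σ.toEmbedding := by
    ext u
    simp only [Finset.mem_compl, Finset.mem_map_equiv]
  simp only [separation, hcompl, Finset.prod_map, Function.comp_apply, Equiv.coe_toEmbedding]

theorem subset_total_of_separation_pos (hs : 0 < separation x s) (ht : 0 < separation x t) :
    s ⊆ t ∨ t ⊆ s := by
  by_contra! hst
  obtain ⟨v, hvs, hvt⟩ := Finset.not_subset.1 hst.1
  obtain ⟨u, hut, hus⟩ := Finset.not_subset.1 hst.2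
  exact lt_asymm (separation_pos_iff.1 hs v hvs u hus) (separation_pos_iff.1 ht u hut v hvt)

theorem exists_mem_faces_separation_pos {K : Z2Complex ι} (x : K.polyhedron) :
    ∃ s ∈ K.faces, 0 < separation x.1 s := by
  obtain ⟨s, hs, hsx⟩ := exists_support_mem_faces x
  refine ⟨s, hs, separation_pos_iff.2 fun v hv u hu => ?_⟩
  exact (not_lt.1 (mt (hsx u).2 hu)).trans_lt ((hsx v).1 hv)

end Separation

theorem hasZ2Map_sd [Finite ι] : K.HasZ2Map K.sd := by
  classical
  have := Fintype.ofFinite ι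
  have hpos : ∀ x : K.polyhedron, ∃ s : {s : Finset ι // s ∈ K.faces}, 0 < separation x.1 s.1 :=
    fun x => let ⟨s, hs, hsx⟩ := exists_mem_faces_separation_pos x; ⟨⟨s, hs⟩, hsx⟩
  refine hasZ2Map_of_weights (fun x s => separation x.1 s.1)
    (fun s => (continuous_separation s.1).comp continuous_subtype_val)
    (fun x s => separation_nonneg x.1 s.1) hpos (fun x => ?_)
    fun x s => separation_comp_equiv K.swap x.1 s.1
  refine ⟨Finset.univ.filter fun s => 0 < separation x.1 s.1, ⟨?_, fun s hs t ht _ => ?_⟩,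
    fun s hs => Finset.mem_filter.2 ⟨Finset.mem_univ s, hs⟩⟩
  · exact (hpos x).imp fun s hs => Finset.mem_filter.2 ⟨Finset.mem_univ s, hs⟩
  · exact subset_total_of_separation_pos (Finset.mem_filter.1 (Finset.mem_coe.1 hs)).2
      (Finset.mem_filter.1 (Finset.mem_coe.1 ht)).2

end Z2Complex

/-! ### Complexes of a graph -/

section Pairs

open Z2Complex

variable {α β : Type*}

theorem swapShores_disjSum (A B : Finset α) : swapShores (A.disjSum B) = B.disjSum A := by
  ext (a | a) <;> simp [swapShores]

theorem toLeft_nonempty_or_toRight_nonempty {S : Finset (α ⊕ β)} (h : S.Nonempty) :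
    S.toLeft.Nonempty ∨ S.toRight.Nonempty := by
  obtain ⟨a | b, hS⟩ := h
  · exact Or.inl ⟨a, Finset.mem_toLeft.2 hS⟩
  · exact Or.inr ⟨b, Finset.mem_toRight.2 hS⟩

theorem disjSum_nonempty {A : Finset α} {B : Finset β} (h : A.Nonempty ∨ B.Nonempty) :
    (A.disjSum B).Nonempty := by
  rcases h with ⟨a, ha⟩ | ⟨b, hb⟩
  · exact ⟨_, Finset.inl_mem_disjSum.2 ha⟩
  · exact ⟨_, Finset.inr_mem_disjSum.2 hb⟩

variable {p : Finset α → Finset α → Prop} {hp : ∀ A B, p A B → p B A}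

theorem pairOrderComplex_hasZ2Map_of_monotone [Finite α] [Finite β]
    {q : Finset β → Finset β → Prop} {hq : ∀ A B, q A B → q B A}
    (f : Finset α → Finset β) (hf : Monotone f)
    (hpq : ∀ A B, A.Nonempty ∨ B.Nonempty → p A B →
      ((f A).Nonempty ∨ (f B).Nonempty) ∧ q (f A) (f B)) :
    (pairOrderComplex p hp).HasZ2Map (pairOrderComplex q hq) := by
  have hpq' := fun S : {S : Finset (α ⊕ α) // S.Nonempty ∧ p S.toLeft S.toRight} =>
    hpq _ _ (toLeft_nonempty_or_toRight_nonempty S.2.1) S.2.2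
  refine orderZ2Complex_hasZ2Map_of_monotone
    (fun S => ⟨(f S.1.toLeft).disjSum (f S.1.toRight), disjSum_nonempty (hpq' S).1, ?_⟩)
    (fun S T hST => ?_) fun S => Subtype.ext ?_
  · rw [Finset.toLeft_disjSum, Finset.toRight_disjSum]
    exact (hpq' S).2
  · exact Finset.disjSum_mono (hf (Finset.toLeft_subset_toLeft hST))
      (hf (Finset.toRight_subset_toRight hST))
  · dsimp only
    rw [toLeft_swapShores, toRight_swapShores, swapShores_disjSum]

theorem pairComplex_hasZ2Map_pairOrderComplex [Finite α] {hmono} :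
    (pairComplex p hp hmono).HasZ2Map (pairOrderComplex p hp) :=
  hasZ2Map_sd (pairComplex p hp hmono)

theorem pairOrderComplex_hasZ2Map_pairComplex [Finite α] {q : Finset α → Finset α → Prop}
    {hq hmono} (hpq : ∀ A B, p A B → q A B) :
    (pairOrderComplex p hp).HasZ2Map (pairComplex q hq hmono) := by
  refine hasZ2Map_of_rel (fun S v => v ∈ S.1) (fun S v hv => Finset.mem_map_of_mem _ hv)
    (fun S => S.2.1) fun c hc => ?_
  obtain ⟨M, -, hM⟩ := exists_isGreatest_of_isChain hc.1 hc.2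
  exact ⟨M.1, ⟨M.2.1, hpq _ _ M.2.2⟩, fun S hS v hv => hM hS hv⟩

end Pairs

theorem exists_and_of_half_lt_sum {ι : Type*} [Fintype ι] {x : ι → ℝ} (hx : ∀ i, 0 ≤ x i)
    (hsum : ∑ i, x i = 1) {P Q : ι → Prop} [DecidablePred P] [DecidablePred Q]
    (hP : 1 / 2 < ∑ i with P i, x i) (hQ : 1 / 2 < ∑ i with Q i, x i) : ∃ i, P i ∧ Q i := by
  classical
  by_contra! hPQ
  have hdisj : Disjoint (Finset.univ.filter P) (Finset.univ.filter Q) :=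
    Finset.disjoint_filter.2 fun i _ => hPQ i
  have hle : ∑ i with P i, x i + ∑ i with Q i, x i ≤ 1 := by
    rw [← Finset.sum_union hdisj, ← hsum]
    exact Finset.sum_le_sum_of_subset_of_nonneg (Finset.subset_univ _) fun i _ _ => hx i
  linarith

section Graph

open Z2Complex

variable {T V : Type*} [TopologicalSpace T] (G : SimpleGraph V)

theorem finite_dart [Finite V] : Finite G.Dart :=
  Finite.of_injective _ SimpleGraph.Dart.toProd_injective

theorem subset_CN_comm {A B : Set V} : A ⊆ G.CN B ↔ B ⊆ G.CN A :=
  ⟨fun h _ hb _ ha => (h ha _ hb).symm, fun h _ ha _ hb => (h hb _ ha).symm⟩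

theorem subset_CN_CN (A : Set V) : A ⊆ G.CN (G.CN A) :=
  (subset_CN_comm G).1 subset_rfl

theorem CN_CN_CN (A : Set V) : G.CN (G.CN (G.CN A)) = G.CN A :=
  (G.CN_anti (subset_CN_CN G A)).antisymm (subset_CN_CN G _)

variable {G}

theorem isBox_iff_forall_adj {A B : Finset V} :
    G.IsBox A B ↔ ∀ a ∈ A, ∀ b ∈ B, G.Adj a b :=
  ⟨And.right, fun h => ⟨Finset.disjoint_left.2 fun a ha hb => (h a ha a hb).ne rfl, h⟩⟩

theorem subset_CN_of_isBox {A B : Finset V} (h : G.IsBox A B) : (B : Set V) ⊆ G.CN A :=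
  fun b hb a ha => h.2 a ha b hb

/-- The edge `(u, v)` gets the weight `p x u * p (ν x) v`. -/
theorem hasZ2Map_boxComplexEdge [Finite V] {ν : Z2Action T} (p : T → V → ℝ)
    (hcont : ∀ v, Continuous fun x => p x v) (hnonneg : ∀ x v, 0 ≤ p x v)
    (hpos : ∀ x, ∃ v, 0 < p x v)
    (hadj : ∀ x u v, 0 < p x u → 0 < p (ν.toHomeomorph x) v → G.Adj u v) :
    ν.HasZ2Map G.boxComplexEdge.polyhedronAction := by
  classical
  have := Fintype.ofFinite V
  have := finite_dart G
  have := Fintype.ofFinite G.Dart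
  let W : T → G.Dart → ℝ := fun x d => p x d.fst * p (ν.toHomeomorph x) d.snd
  let A : T → Finset V := fun x => {v | 0 < p x v}
  have hA : ∀ x, (A x).Nonempty := fun x =>
    (hpos x).imp fun v hv => Finset.mem_filter.2 ⟨Finset.mem_univ v, hv⟩
  have hbox : ∀ x, G.IsBox (A x) (A (ν.toHomeomorph x)) := fun x =>
    isBox_iff_forall_adj.2 fun u hu v hv =>
      hadj x u v (Finset.mem_filter.1 hu).2 (Finset.mem_filter.1 hv).2
  have hWpos : ∀ x, ∃ d, 0 < W x d := fun x => by
    obtain ⟨u, hu⟩ := hpos x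
    obtain ⟨v, hv⟩ := hpos (ν.toHomeomorph x)
    exact ⟨⟨(u, v), hadj x u v hu hv⟩, mul_pos hu hv⟩
  have hWA : ∀ x d, 0 < W x d → d.fst ∈ A x ∧ d.snd ∈ A (ν.toHomeomorph x) := fun x d hd =>
    ⟨Finset.mem_filter.2 ⟨Finset.mem_univ _, pos_of_mul_pos_left hd (hnonneg _ _)⟩,
      Finset.mem_filter.2 ⟨Finset.mem_univ _, pos_of_mul_pos_right hd (hnonneg _ _)⟩⟩
  refine hasZ2Map_of_weights W
    (fun d => (hcont _).mul ((hcont _).comp ν.toHomeomorph.continuous))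
    (fun x d => mul_nonneg (hnonneg _ _) (hnonneg _ _)) hWpos (fun x => ?_) fun x d => ?_
  · refine ⟨Finset.univ.filter fun d => 0 < W x d, ⟨?_, A x, A (ν.toHomeomorph x), hA x, hA _,
      hbox x, fun d hd => hWA x d (Finset.mem_filter.1 hd).2⟩,
      fun d hd => Finset.mem_filter.2 ⟨Finset.mem_univ d, hd⟩⟩
    exact (hWpos x).imp fun d hd => Finset.mem_filter.2 ⟨Finset.mem_univ d, hd⟩
  · simp only [W, ν.involutive x]
    exact mul_comm _ _

theorem boxComplexOne_hasZ2Map_boxComplex [Finite V] :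
    G.boxComplexOne.HasZ2Map G.boxComplex :=
  pairOrderComplex_hasZ2Map_pairComplex fun _ _ ⟨hA, hB, hbox⟩ =>
    ⟨hbox, Set.Nonempty.mono (subset_CN_of_isBox hbox) hB,
      Set.Nonempty.mono (subset_CN_of_isBox hbox.symm) hA⟩

theorem boxComplexOne_hasZ2Map_boxComplexZero [Finite V] :
    G.boxComplexOne.HasZ2Map G.boxComplexZero :=
  pairOrderComplex_hasZ2Map_pairComplex fun _ _ h => h.2.2

/-- A pair `A' ⊎ A''` goes to the midpoint of `CN(CN(A')) ⊆ CN(A'')`, where the term of an empty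
shore is omitted. -/
theorem boxComplex_hasZ2Map_lovaszComplex [Finite V] :
    G.boxComplex.HasZ2Map G.lovaszComplex := by
  refine pairComplex_hasZ2Map_pairOrderComplex.trans (orderZ2Complex_hasZ2Map_of_rel
    (fun S A => (S.1.toLeft.Nonempty ∧ A.1 = G.CN (G.CN S.1.toLeft)) ∨
      (S.1.toRight.Nonempty ∧ A.1 = G.CN S.1.toRight)) ?_ ?_ ?_)
  · rintro S A (⟨hne, hA⟩ | ⟨hne, hA⟩) <;> dsimp only <;>
      rw [toLeft_swapShores, toRight_swapShores, hA]
    · exact Or.inr ⟨hne, CN_CN_CN G _⟩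
    · exact Or.inl ⟨hne, rfl⟩
  · rintro ⟨S, hne, -, hleft, hright⟩
    rcases toLeft_nonempty_or_toRight_nonempty hne with hS | hS
    · exact ⟨⟨G.CN (G.CN S.toLeft), Set.Nonempty.mono (subset_CN_CN G _) hS,
        by rwa [CN_CN_CN], by rw [CN_CN_CN]⟩, Or.inl ⟨hS, rfl⟩⟩
    · exact ⟨⟨G.CN S.toRight, hright, Set.Nonempty.mono (subset_CN_CN G _) hS,
        CN_CN_CN G _⟩, Or.inr ⟨hS, rfl⟩⟩
  · intro S T hST A B hA hB
    have hleft : (S.1.toLeft : Set V) ⊆ T.1.toLeft :=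
      Finset.coe_subset.2 (Finset.toLeft_subset_toLeft hST)
    have hright : (S.1.toRight : Set V) ⊆ T.1.toRight :=
      Finset.coe_subset.2 (Finset.toRight_subset_toRight hST)
    have hT : (T.1.toRight : Set V) ⊆ G.CN T.1.toLeft := subset_CN_of_isBox T.2.2.1
    change A.1 ⊆ B.1 ∨ B.1 ⊆ A.1
    rcases hA with ⟨-, hA⟩ | ⟨-, hA⟩ <;> rcases hB with ⟨-, hB⟩ | ⟨-, hB⟩ <;> rw [hA, hB]
    · exact Or.inl (G.CN_anti (G.CN_anti hleft))
    · exact Or.inl (G.CN_anti (hT.trans (G.CN_anti hleft)))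
    · exact Or.inr (G.CN_anti (hright.trans hT))
    · exact Or.inr (G.CN_anti hright)

/-- A point `x` of `|L(G)|` is a probability distribution on closed sets `A`. The weight of `u` is
the excess of the probability of `u ∈ A` over one half; if it is positive, and so is that of `v`
at the image of `x`, then some `A` contains `u` and has `v` as a common neighbour. -/
theorem lovaszComplex_hasZ2Map_boxComplexEdge [Finite V] :
    G.lovaszComplex.HasZ2Map G.boxComplexEdge := by
  classical
  have := Fintype.ofFinite {A : Set V // A.Nonempty ∧ (G.CN A).Nonempty ∧ G.CN (G.CN A) = A}
  have hexcess : ∀ {r : ℝ}, 0 < max 0 (r - 1 / 2) ↔ 1 / 2 < r := fun {r} => by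
    rw [lt_max_iff, or_iff_right (lt_irrefl 0), sub_pos]
  refine hasZ2Map_boxComplexEdge (fun x u => max 0 ((∑ A with u ∈ A.1, x.1 A) - 1 / 2))
    (fun u => ?_) (fun _ _ => le_max_left _ _) (fun x => ?_) fun x u v hu hv => ?_
  · exact continuous_const.max ((continuous_finsetSum _ fun A _ =>
      continuous_coord A).sub continuous_const)
  · obtain ⟨c, hc, hcx⟩ := exists_support_mem_faces x
    obtain ⟨A, -, hA⟩ := exists_isLeast_of_isChain hc.1 hc.2
    obtain ⟨u, hu⟩ := A.2.1
    refine ⟨u, hexcess.2 ?_⟩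
    rw [Finset.sum_filter_of_ne fun B _ hB =>
      hA ((hcx B).2 ((x.2.1 B).lt_of_ne' hB)) hu, sum_coord_eq_one]
    norm_num
  · have hv' : 1 / 2 < ∑ A with v ∈ G.CN A.1, x.1 A := by
      refine (hexcess.1 hv).trans_eq (Finset.sum_equiv G.lovaszComplex.swap (fun A => ?_)
        fun _ _ => rfl)
      simp only [Finset.mem_filter, Finset.mem_univ, true_and]
      exact iff_of_eq (congrArg (v ∈ ·) A.2.2.2.symm)
    obtain ⟨A, huA, hvA⟩ :=
      exists_and_of_half_lt_sum x.2.1 (sum_coord_eq_one x) (hexcess.1 hu) hv'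
    exact hvA u huA

theorem boxComplexEdge_hasZ2Map_boxComplexOne [Finite V] :
    G.boxComplexEdge.HasZ2Map G.boxComplexOne := by
  classical
  have := finite_dart G
  let shores : Finset G.Dart → Finset (V ⊕ V) := fun D =>
    (D.image (·.fst)).disjSum (D.image (·.snd))
  have hbox : ∀ D ∈ G.boxComplexEdge.faces, G.IsBox (D.image (·.fst)) (D.image (·.snd)) := by
    rintro D ⟨-, A, B, -, -, hAB, hD⟩
    exact hAB.mono (Finset.image_subset_iff.2 fun d hd => (hD d hd).1)
      (Finset.image_subset_iff.2 fun d hd => (hD d hd).2)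
  have hswap : ∀ D, shores (D.map G.boxComplexEdge.swap.toEmbedding) = swapShores (shores D) := by
    intro D
    simp only [shores, swapShores_disjSum, Finset.map_eq_image, Finset.image_image]
    rfl
  suffices hsd : G.boxComplexEdge.sd.HasZ2Map G.boxComplexOne from (hasZ2Map_sd _).trans hsd
  unfold SimpleGraph.boxComplexOne pairOrderComplex
  refine orderZ2Complex_hasZ2Map_of_monotone
    (fun D => ⟨shores D.1, disjSum_nonempty (Or.inl (D.2.1.image _)), ?_⟩) (fun D E hDE => ?_)
    fun D => Subtype.ext (hswap D.1)
  · rw [Finset.toLeft_disjSum, Finset.toRight_disjSum]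
    exact ⟨D.2.1.image _, D.2.1.image _, hbox D.1 D.2⟩
  · exact Finset.disjSum_mono (Finset.image_subset_image hDE) (Finset.image_subset_image hDE)

variable (G) in
/-- The difference of the masses of the shores is odd; where it vanishes both shores are nonempty,
which leads to `B_edge(G)`. -/
theorem ind_boxComplexZero_le_ind_boxComplexEdge_add_one [Finite V] :
    G.boxComplexZero.ind ≤ G.boxComplexEdge.ind + 1 := by
  have := Fintype.ofFinite V
  let b : G.boxComplexZero.polyhedron → ℝ := fun x =>
    ∑ u, x.1 (Sum.inl u) - ∑ u, x.1 (Sum.inr u)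
  have hb : Continuous b :=
    (continuous_finsetSum _ fun u _ => continuous_coord (Sum.inl u)).sub
      (continuous_finsetSum _ fun u _ => continuous_coord (Sum.inr u))
  have hodd : ∀ x, b (G.boxComplexZero.polyhedronAction.toHomeomorph x) = -b x := fun x =>
    (neg_sub _ _).symm
  refine (Z2Action.z2Index_le_z2Index_restrict_add_one hb hodd).trans
    (add_le_add_left (Z2Action.HasZ2Map.z2Index_le_z2Index ?_) 1)
  refine hasZ2Map_boxComplexEdge (fun x u => x.1.1 (Sum.inl u))
    (fun u => (continuous_coord _).comp continuous_subtype_val) (fun x u => x.1.2.1 _)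
    (fun x => ?_) fun x u v hu hv => ?_
  · by_contra! hle
    have hleft : ∑ u, x.1.1 (Sum.inl u) ≤ 0 := Finset.sum_nonpos fun u _ => hle u
    have hb0 : b x.1 = 0 := x.2
    have hsum := sum_coord_eq_one x.1
    rw [Fintype.sum_sum_type] at hsum
    linarith
  · obtain ⟨S, hS, hSx⟩ := exists_support_mem_faces x.1
    exact hS.2.2 u (Finset.mem_toLeft.2 ((hSx _).2 hu)) v (Finset.mem_toRight.2 ((hSx _).2 hv))

end Graph

/-! ### Kneser representations -/

section Kneser

variable {X V : Type*} {G : SimpleGraph V} {r : V → Finset X}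

/-- The vertices represented by subsets of `B`: in a Kneser representation `r` this turns pairs of
subsets of `X` into pairs of subsets of `V`, in the direction opposite to
`A ↦ A.biUnion r`. -/
noncomputable def membersWithin [Finite V] (r : V → Finset X) (B : Finset X) : Finset V :=
  (Set.toFinite {v | r v ⊆ B}).toFinset

theorem mem_membersWithin [Finite V] {B : Finset X} {v : V} :
    v ∈ membersWithin r B ↔ r v ⊆ B :=
  Set.Finite.mem_toFinset _

theorem membersWithin_mono [Finite V] : Monotone (membersWithin r) :=
  fun _ _ hAB _ hv => mem_membersWithin.2 ((mem_membersWithin.1 hv).trans hAB)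

theorem membersWithin_nonempty [Finite V] {B : Finset X} (h : ∃ C ∈ Set.range r, C ⊆ B) :
    (membersWithin r B).Nonempty := by
  obtain ⟨_, ⟨v, rfl⟩, hv⟩ := h
  exact ⟨v, mem_membersWithin.2 hv⟩

theorem exists_mem_range_subset_biUnion [DecidableEq X] {A : Finset V} (h : A.Nonempty) :
    ∃ C ∈ Set.range r, C ⊆ A.biUnion r := by
  obtain ⟨a, ha⟩ := h
  exact ⟨r a, ⟨a, rfl⟩, Finset.subset_biUnion_of_mem r ha⟩

theorem biUnion_mono [DecidableEq X] : Monotone fun A : Finset V => A.biUnion r :=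
  fun _ _ hAB => Finset.biUnion_subset_biUnion_of_subset_left r hAB

variable (hr : ∀ u v, G.Adj u v ↔ Disjoint (r u) (r v))
include hr

theorem nonempty_of_adj_iff_disjoint (v : V) : (r v).Nonempty := by
  rw [Finset.nonempty_iff_ne_empty, ne_eq, ← Finset.disjoint_self_iff_empty, ← hr]
  exact G.irrefl

theorem nonempty_of_exists_mem_range_subset {B : Finset X} (h : ∃ C ∈ Set.range r, C ⊆ B) :
    B.Nonempty := by
  obtain ⟨_, ⟨v, rfl⟩, hv⟩ := h
  exact (nonempty_of_adj_iff_disjoint hr v).mono hv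

theorem isBox_iff_disjoint_biUnion [DecidableEq X] {A B : Finset V} :
    G.IsBox A B ↔ Disjoint (A.biUnion r) (B.biUnion r) := by
  rw [isBox_iff_forall_adj, Finset.disjoint_biUnion_left]
  simp only [Finset.disjoint_biUnion_right, hr]

theorem isBox_membersWithin [Finite V] {A B : Finset X} (h : Disjoint A B) :
    G.IsBox (membersWithin r A) (membersWithin r B) :=
  isBox_iff_forall_adj.2 fun _ hu _ hv =>
    (hr _ _).2 (h.mono (mem_membersWithin.1 hu) (mem_membersWithin.1 hv))

variable [Finite X] [Finite V]

theorem boxComplexOne_hasZ2Map_kneserBoxComplexOne :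
    G.boxComplexOne.HasZ2Map (kneserBoxComplexOne (Set.range r)) := by
  classical
  refine pairOrderComplex_hasZ2Map_of_monotone _ (biUnion_mono (r := r)) ?_
  rintro A B - ⟨hA, hB, hAB⟩
  have hA' := exists_mem_range_subset_biUnion (r := r) hA
  exact ⟨Or.inl (nonempty_of_exists_mem_range_subset hr hA'),
    (isBox_iff_disjoint_biUnion hr).1 hAB, hA', exists_mem_range_subset_biUnion hB⟩

theorem kneserBoxComplexOne_hasZ2Map_boxComplexOne :
    (kneserBoxComplexOne (Set.range r)).HasZ2Map G.boxComplexOne := by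
  refine pairOrderComplex_hasZ2Map_of_monotone _ (membersWithin_mono (r := r)) ?_
  rintro A B - ⟨hAB, hA, hB⟩
  exact ⟨Or.inl (membersWithin_nonempty hA), membersWithin_nonempty hA,
    membersWithin_nonempty hB, isBox_membersWithin hr hAB⟩

theorem boxComplexZero_hasZ2Map_sarkariaComplex :
    G.boxComplexZero.HasZ2Map (sarkariaComplex (Set.range r)) := by
  classical
  refine pairComplex_hasZ2Map_pairOrderComplex.trans
    (pairOrderComplex_hasZ2Map_of_monotone _ (biUnion_mono (r := r)) ?_)
  intro A B hne hAB
  have hsub := hne.imp (exists_mem_range_subset_biUnion (r := r))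
    (exists_mem_range_subset_biUnion (r := r))
  exact ⟨hsub.imp (nonempty_of_exists_mem_range_subset hr)
    (nonempty_of_exists_mem_range_subset hr), (isBox_iff_disjoint_biUnion hr).1 hAB, hsub⟩

theorem sarkariaComplex_hasZ2Map_boxComplexZero :
    (sarkariaComplex (Set.range r)).HasZ2Map G.boxComplexZero := by
  refine Z2Action.HasZ2Map.trans (pairOrderComplex_hasZ2Map_of_monotone
      (hq := fun _ _ h => h.symm) _ (membersWithin_mono (r := r)) ?_)
    (pairOrderComplex_hasZ2Map_pairComplex fun _ _ => id)
  rintro A B - ⟨hAB, hsub⟩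
  exact ⟨hsub.imp membersWithin_nonempty membersWithin_nonempty, isBox_membersWithin hr hAB⟩

end Kneser

theorem mainTheorem2_general {X V : Type*} [Finite X] [Finite V] (G : SimpleGraph V)
    (r : V → Finset X) (hr : ∀ u v, G.Adj u v ↔ Disjoint (r u) (r v)) :
    G.boxComplexOne.ind = (kneserBoxComplexOne (Set.range r)).ind ∧
    (kneserBoxComplexOne (Set.range r)).ind = G.boxComplexEdge.ind ∧
    G.boxComplexEdge.ind = G.boxComplex.ind ∧
    G.boxComplex.ind = G.lovaszComplex.ind ∧
    G.lovaszComplex.ind ≤ G.boxComplexZero.ind ∧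
    G.boxComplexZero.ind = (sarkariaComplex (Set.range r)).ind ∧
    (sarkariaComplex (Set.range r)).ind ≤ G.boxComplexOne.ind + 1 := by
  have hOneBox : G.boxComplexOne.ind ≤ G.boxComplex.ind :=
    boxComplexOne_hasZ2Map_boxComplex.z2Index_le_z2Index
  have hBoxLovasz : G.boxComplex.ind ≤ G.lovaszComplex.ind :=
    boxComplex_hasZ2Map_lovaszComplex.z2Index_le_z2Index
  have hLovaszEdge : G.lovaszComplex.ind ≤ G.boxComplexEdge.ind :=
    lovaszComplex_hasZ2Map_boxComplexEdge.z2Index_le_z2Index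
  have hEdgeOne : G.boxComplexEdge.ind ≤ G.boxComplexOne.ind :=
    boxComplexEdge_hasZ2Map_boxComplexOne.z2Index_le_z2Index
  have hOneZero : G.boxComplexOne.ind ≤ G.boxComplexZero.ind :=
    boxComplexOne_hasZ2Map_boxComplexZero.z2Index_le_z2Index
  have hEdge : G.boxComplexEdge.ind = G.boxComplexOne.ind :=
    hEdgeOne.antisymm (hOneBox.trans (hBoxLovasz.trans hLovaszEdge))
  have hOneKneser : G.boxComplexOne.ind = (kneserBoxComplexOne (Set.range r)).ind :=
    (boxComplexOne_hasZ2Map_kneserBoxComplexOne hr).z2Index_le_z2Index.antisymm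
      (kneserBoxComplexOne_hasZ2Map_boxComplexOne hr).z2Index_le_z2Index
  have hZeroSark : G.boxComplexZero.ind = (sarkariaComplex (Set.range r)).ind :=
    (boxComplexZero_hasZ2Map_sarkariaComplex hr).z2Index_le_z2Index.antisymm
      (sarkariaComplex_hasZ2Map_boxComplexZero hr).z2Index_le_z2Index
  exact ⟨hOneKneser, hOneKneser.symm.trans hEdge.symm,
    (hEdgeOne.trans hOneBox).antisymm (hBoxLovasz.trans hLovaszEdge),
    hBoxLovasz.antisymm (hLovaszEdge.trans (hEdgeOne.trans hOneBox)),
    hLovaszEdge.trans (hEdgeOne.trans hOneZero), hZeroSark,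
    hZeroSark ▸ hEdge ▸ ind_boxComplexZero_le_ind_boxComplexEdge_add_one G⟩

theorem adj_iff_disjoint_of_iso_kneserGraph {X V : Type*} {F : Set (Finset X)} (hF : ∅ ∉ F)
    {G : SimpleGraph V} (e : G ≃g kneserGraph F) (u v : V) :
    G.Adj u v ↔ Disjoint (e u).1 (e v).1 := by
  refine ⟨fun h => (e.map_adj_iff.2 h).2, fun h => e.map_adj_iff.1 ⟨fun huv => hF ?_, h⟩⟩
  rw [huv, Finset.disjoint_self_iff_empty] at h
  exact h ▸ (e v).2

theorem mainTheorem2 {X V : Type*} [Finite X] [Finite V] (F : Set (Finset X)) (hF : ∅ ∉ F)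
    (G : SimpleGraph V) (e : G ≃g kneserGraph F) (hG : ∀ v, ¬ G.IsIsolated v) :
    G.boxComplexOne.ind = (kneserBoxComplexOne F).ind ∧
    (kneserBoxComplexOne F).ind = G.boxComplexEdge.ind ∧
    G.boxComplexEdge.ind = G.boxComplex.ind ∧
    G.boxComplex.ind = G.lovaszComplex.ind ∧
    G.lovaszComplex.ind ≤ G.boxComplexZero.ind ∧
    G.boxComplexZero.ind = (sarkariaComplex F).ind ∧
    (sarkariaComplex F).ind ≤ G.boxComplexOne.ind + 1 := by
  have hrange : Set.range (fun v => (e v).1) = F :=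
    (e.surjective.range_comp Subtype.val).trans Subtype.range_val
  have h := mainTheorem2_general G _ (adj_iff_disjoint_of_iso_kneserGraph hF e)
  rwa [hrange] at h
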